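/- Let $\mathbb N=\{0,1,2,\dots\}$, $\mathbb N^+=\mathbb N\setminus\{0\}$, and let $\Sigma$ be a finite alphabet. A sequence $\rho:\mathbb N\to\Gamma$ over a finite alphabet $\Gamma$ is \emph{pure morphic} if $\rho=f^\infty(a)=\lim_n f^n(a)$ for some $f:\Gamma\to\Gamma^+$ and $a\in\Gamma$ with $f(a)=au$, $u\in\Gamma^+$. A sequence $\sigma:\mathbb N\to\Sigma$ is \emph{morphic} if $\sigma=\tau\circ\rho$ for some finite alphabet $\Gamma$, some pure morphic sequence $\rho$ over $\Gamma$ and some map $\tau:\Gamma\to\Sigma$. An \emph{infinite term} over a signature $S$ with arities $\mathrm{ar}:S\to\mathbb N^+$ is a map $t:\mathbb N^*\to S\cup\{\bot\}$ with $t(\epsilon)\in S$ such that, for all $p\in\mathbb N^*$ and $i\in\mathbb N$, $t(pi)\in S$ if and only if $t(p)\in S$ and $i<\mathrm{ar}(t(p))$. The $p$ with $t(p)\in S$ are its \emph{positions}; the \emph{subterm} of $t$ at a position $p$ is $t_p:q\mapsto t(pq)$; and $t$ is \emph{rational} if it has only finitely many distinct subterms. A \emph{tree function} is a weakly monotone surjective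 map $P:\mathbb N^+\to\mathbb N$. It defines an ordered tree on the node set $\mathbb N$ with root $0$, in which $P(j)$ is the parent of $j$ and the children of each node are ordered increasingly; every node has finitely many children, and at least one. As an unlabelled ordered tree, it is the infinite term whose positions are the words $p\in\mathbb N^*$ describing downward paths from the root (the letter $i$ means: go to the $(i+1)$-th child) and whose symbol at $p$ is the number of children of the node reached. $P$ is a \emph{rational tree function} if this tree has only finitely many distinct subtrees (that is, this term is rational). Let $\Delta$ be the set of these subtrees, the arity of a subtree being the number of children of its root, and let $t_P$ be the infinite term over $\Delta$ with the same positions whose symbol at $p$ is the subtree at $p$. Number the positions of $t_P$ from $0$ in breadth-first order (shorter positions first, positions of equal length lexicographically) and write $\nu(p)$ for the number of $p$. For $\sigma:\mathbb N\to\Sigma$ let $t_{P,\sigma}$ be the infinite term over $\Delta\times\Sigma$, where $(s,b)$ has the arity of $s$, with the same positions as $t_P$ and with $t_{P,\sigma}(p)=(t_P(p),\sigma(\nu(p)))$. \textbf{Theorem.} A sequence $\sigma:\mathbb N\to\Sigma$ over a finite alphabet $\Sigma$ is morphic if and only if there exists a rational tree function $P:\mathbb N^+\to\mathbb N$ such that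 the infinite term $t_{P,\sigma}$ is rational. -/

import Mathlib

namespace MorphicSeq

/-! ### Morphic sequences -/

/-- A morphism `f : Γ → Γ*`, lifted to words. -/
def applyWord {Γ : Type*} (f : Γ → List Γ) (w : List Γ) : List Γ := w.flatMap f

/-- The sequence `ρ` is the limit of the words `w 0, w 1, w 2, …`: for every index `i`,
all but finitely many of these words have an `i`-th entry and it is `ρ i`. -/
def IsLimitOfWords {Γ : Type*} (w : ℕ → List Γ) (ρ : ℕ → Γ) : Prop :=
  ∀ i : ℕ, ∀ᶠ n in Filter.atTop, (w n)[i]? = some (ρ i)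

/-- `ρ` is pure morphic over the finite alphabet `Γ`: it is `f^∞(a) = lim f^n(a)` for some
`f : Γ → Γ⁺` and `a ∈ Γ` with `f(a) = a u`, `u ∈ Γ⁺`. -/
def IsPureMorphic {Γ : Type*} (ρ : ℕ → Γ) : Prop :=
  Finite Γ ∧ ∃ (f : Γ → List Γ) (a : Γ) (u : List Γ),
    (∀ b, f b ≠ []) ∧ u ≠ [] ∧ f a = a :: u ∧
      IsLimitOfWords (fun n => (applyWord f)^[n] [a]) ρ

/-- `σ` is morphic: the image of a pure morphic sequence over a finite alphabet under a coding. -/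
def IsMorphic {A : Type*} (σ : ℕ → A) : Prop :=
  ∃ (Γ : Type) (τ : Γ → A) (ρ : ℕ → Γ), IsPureMorphic ρ ∧ σ = τ ∘ ρ

/-! ### Infinite terms -/

/-- Infinite terms over the signature `S` with arities `ar`, as maps `ℕ* → S ∪ {⊥}`. -/
@[ext]
structure InfTerm {S : Type*} (ar : S → ℕ+) where
  toFun : List ℕ → Option S
  root : (toFun []).isSome
  child : ∀ (p : List ℕ) (i : ℕ),
    (toFun (p ++ [i])).isSome ↔ ∃ f, toFun p = some f ∧ i < (ar f : ℕ)

namespace InfTerm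

variable {S : Type*} {ar : S → ℕ+}

/-- `p` is a position of the term `t`. -/
def IsPos (t : InfTerm ar) (p : List ℕ) : Prop := (t.toFun p).isSome

/-- The symbol at a position. -/
def symbol (t : InfTerm ar) (p : List ℕ) (h : t.IsPos p) : S := (t.toFun p).get h

/-- The subterm `t_p`, given by `t_p(q) = t(pq)`. -/
def subterm (t : InfTerm ar) (p : List ℕ) (h : t.IsPos p) : InfTerm ar where
  toFun q := t.toFun (p ++ q)
  root := by simpa [IsPos] using h
  child q i := by rw [← List.append_assoc]; exact t.child (p ++ q) i

/-- The set of all subterms of a term. -/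
def subterms (t : InfTerm ar) : Set (InfTerm ar) := {s | ∃ p h, s = t.subterm p h}

/-- A term is rational if it has only finitely many distinct subterms. -/
def IsRational (t : InfTerm ar) : Prop := t.subterms.Finite

/-- The number of a position of `t` in the breadth-first numbering (starting at `0`): how many
positions of `t` come before it, being shorter, or equally long and lexicographically smaller. -/
noncomputable def number (t : InfTerm ar) (p : List ℕ) : ℕ :=
  {q : List ℕ | t.IsPos q ∧ List.Shortlex (· < ·) q p}.ncard

theorem isPos_append_iff (t : InfTerm ar) (p : List ℕ) (i : ℕ) :
    t.IsPos (p ++ [i]) ↔ ∃ h : t.IsPos p, i < (ar (t.symbol p h) : ℕ) := by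
  unfold IsPos symbol
  rw [t.child]
  constructor
  · rintro ⟨f, hf, hi⟩
    exact ⟨by simp [hf], by simpa [hf] using hi⟩
  · rintro ⟨h, hi⟩
    exact ⟨_, (Option.some_get h).symm, hi⟩

end InfTerm

/-! ### Tree functions and their trees -/

/-- A tree function: a weakly monotone and surjective map `P : ℕ⁺ → ℕ`. In the corresponding tree
on the node set `ℕ`, the root is `0` and the parent of `j > 0` is `P j`. -/
structure TreeFunction where
  toFun : ℕ+ → ℕ
  mono : Monotone toFun
  surj : Function.Surjective toFun

/-- Unlabelled ordered trees in which every node has finitely many children, and at least one, seen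
as infinite terms: the symbol at a node is its number of children. -/
abbrev OrderedTree := InfTerm (S := ℕ+) id

namespace TreeFunction

/-- The set of children of the node `n`. -/
def children (P : TreeFunction) (n : ℕ) : Set ℕ := {m | ∃ h : 0 < m, P.toFun ⟨m, h⟩ = n}

theorem children_finite (P : TreeFunction) (n : ℕ) : (P.children n).Finite := by
  obtain ⟨k, hk⟩ := P.surj (n + 1)
  refine (Set.finite_Iio (k : ℕ)).subset ?_
  rintro m ⟨h, hm⟩
  by_contra hlt
  have h1 : k ≤ ⟨m, h⟩ := by
    exact PNat.coe_le_coe _ _ |>.mp (not_lt.mp hlt)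
  have h2 := P.mono h1
  omega

theorem children_nonempty (P : TreeFunction) (n : ℕ) : (P.children n).Nonempty := by
  obtain ⟨k, hk⟩ := P.surj n
  exact ⟨k, k.pos, hk⟩

/-- The number of children of the node `n`. -/
noncomputable def arity (P : TreeFunction) (n : ℕ) : ℕ+ :=
  ⟨(P.children n).ncard, (Set.ncard_pos (P.children_finite n)).mpr (P.children_nonempty n)⟩

/-- The children of `n` in increasing order are `child P n 0 < child P n 1 < …`, up to index
`arity P n - 1`. -/
noncomputable def child (P : TreeFunction) (n i : ℕ) : ℕ := Nat.nth (· ∈ P.children n) i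

/-- The node reached from the node `n` along the position `p`, if there is one. -/
noncomputable def nodeFrom (P : TreeFunction) : ℕ → List ℕ → Option ℕ
  | n, [] => some n
  | n, i :: p => if i < (P.arity n : ℕ) then P.nodeFrom (P.child n i) p else none

theorem nodeFrom_append (P : TreeFunction) (n : ℕ) (p q : List ℕ) :
    P.nodeFrom n (p ++ q) = (P.nodeFrom n p).bind fun m => P.nodeFrom m q := by
  induction p generalizing n with
  | nil => rfl
  | cons i p ih =>
    simp only [List.cons_append, nodeFrom]
    split_ifs
    · exact ih _
    · rfl

/-- The ordered tree corresponding to `P`: the children of every node are ordered by `<`. -/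
noncomputable def tree (P : TreeFunction) : OrderedTree where
  toFun p := (P.nodeFrom 0 p).map P.arity
  root := rfl
  child p i := by
    rw [nodeFrom_append]
    cases P.nodeFrom 0 p with
    | none => simp
    | some m =>
      by_cases h : i < (P.arity m : ℕ) <;> simp [nodeFrom, h]

/-- `P` is a rational tree function: its tree has only finitely many distinct subtrees. -/
def IsRational (P : TreeFunction) : Prop := P.tree.IsRational

/-- The signature `Δ` of `t_P`: the subtrees of the tree of `P`. -/
abbrev Subtree (P : TreeFunction) : Type := P.tree.subterms

/-- The arity of a subtree in `Δ`: the number of children of its root. -/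
def Subtree.arity {P : TreeFunction} (s : P.Subtree) : ℕ+ := s.1.symbol [] s.1.root

open Classical in
/-- The tree of `P` as an infinite term `t_P` over `Δ`: the symbol at a position is the subtree at
that position. -/
noncomputable def term (P : TreeFunction) : InfTerm (S := P.Subtree) Subtree.arity where
  toFun p := if h : P.tree.IsPos p then some ⟨P.tree.subterm p h, p, h, rfl⟩ else none
  root := by
    have h : P.tree.IsPos [] := P.tree.root
    simp [h]
  child p i := by
    have key := P.tree.isPos_append_iff p i
    by_cases h : P.tree.IsPos p
    · by_cases h' : P.tree.IsPos (p ++ [i])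
      · obtain ⟨_, hi⟩ := key.mp h'
        simpa [h, h', Subtree.arity, InfTerm.subterm, InfTerm.symbol] using hi
      · have hi : ¬ i < (P.tree.symbol p h : ℕ) := fun hi => h' (key.mpr ⟨h, hi⟩)
        simpa [h, h', Subtree.arity, InfTerm.subterm, InfTerm.symbol] using hi
    · have h' : ¬ P.tree.IsPos (p ++ [i]) := fun h' => h (key.mp h').1
      simp [h, h']

/-- The infinite term `t_{P,σ}` over `Δ × A`, where `(s, a)` has the arity of `s`: every position
of `t_P` is moreover labelled by `σ i`, where `i` is its breadth-first number. -/
noncomputable def labelledTerm {A : Type*} (P : TreeFunction) (σ : ℕ → A) :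
    InfTerm (S := P.Subtree × A) (fun x => Subtree.arity x.1) where
  toFun p := (P.term.toFun p).map fun s => (s, σ (P.term.number p))
  root := by simpa using P.term.root
  child p i := by
    have key := P.term.child p i
    cases h : P.term.toFun p <;> simpa [h] using key

end TreeFunction

end MorphicSeq

namespace MorphicSeq

/-! ### Pure morphic sequences as fixed points -/

/-! By monotonicity and surjectivity of `P`, the children of `n` form an interval `[s n, s (n + 1))`
with `s 0 = 1` and `s` strictly increasing (`exists_starts`, converse `exists_of_starts`). The
breadth-first number of a position is the node it leads to (`number_eq`), so node `n` carries the
label `σ n`. Rationality of the labelled term thus amounts to a finite colouring of the nodes in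
which a colour determines the label and the word of the children's colours. Sending each colour to
that word is a morphism, and concatenating the words of all nodes gives back the colours of all
nodes except the root, which is nobody's child. An extra letter for the root, whose image starts
with itself, turns the colour sequence into a fixed point. Conversely, if `ρ` is the limit of the
iterates of `f`, it is the concatenation of the blocks `f (ρ n)`; node `n` becomes the parent of the
indices in its block, with index `0` removed from the first block. -/

theorem applyWord_append {Γ : Type*} (f : Γ → List Γ) (v w : List Γ) :
    applyWord f (v ++ w) = applyWord f v ++ applyWord f w := by
  simp [applyWord]

/-- If `f` maps prefixes of `ρ` to longer prefixes of `ρ`, then `ρ` is the limit of the iterates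
of `f` on the first letter of `ρ`. -/
theorem isLimitOfWords_of_prefixes {Γ : Type*} {f : Γ → List Γ} {ρ : ℕ → Γ} {S : ℕ → ℕ}
    (hS : ∀ n, n < S n)
    (h : ∀ n, 1 ≤ n → applyWord f ((List.range n).map ρ) = (List.range (S n)).map ρ) :
    IsLimitOfWords (fun n => (applyWord f)^[n] [ρ 0]) ρ := by
  have key : ∀ n, ∃ L, n < L ∧ (applyWord f)^[n] [ρ 0] = (List.range L).map ρ := by
    intro n
    induction n with
    | zero => exact ⟨1, by simp, by simp⟩
    | succ n ih =>
      obtain ⟨L, hL, e⟩ := ih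
      refine ⟨S L, by have := hS L; omega, ?_⟩
      rw [Function.iterate_succ_apply', e, h L (by omega)]
  intro i
  filter_upwards [Filter.eventually_ge_atTop i] with n hn
  obtain ⟨L, hL, e⟩ := key n
  have hi : i < L := by omega
  simp [e, hi]

theorem take_eq_map_range {Γ : Type*} {w : List Γ} {ρ : ℕ → Γ} {n : ℕ}
    (h : ∀ k < n, w[k]? = some (ρ k)) : w.take n = (List.range n).map ρ := by
  apply List.ext_getElem?
  intro k
  by_cases hk : k < n
  · simp [hk, h k hk]
  · simp [hk]

/-- The length of the image under `f` of the prefix of length `n` of `ρ`. -/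
def imageLength {Γ : Type*} (f : Γ → List Γ) (ρ : ℕ → Γ) (n : ℕ) : ℕ :=
  (applyWord f ((List.range n).map ρ)).length

theorem imageLength_succ {Γ : Type*} (f : Γ → List Γ) (ρ : ℕ → Γ) (n : ℕ) :
    imageLength f ρ (n + 1) = imageLength f ρ n + (f (ρ n)).length := by
  simp [imageLength, List.range_succ, applyWord]

/-- This is the fixed-point property of `ρ`, block by block: an iterate that agrees with `ρ` on `n +
1` letters is mapped to a word in which `f (ρ n)` starts at `imageLength f ρ n`, and that word is
again an iterate. -/
theorem IsLimitOfWords.getElem?_image {Γ : Type*} {f : Γ → List Γ} {a : Γ} {ρ : ℕ → Γ}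
    (h : IsLimitOfWords (fun n => (applyWord f)^[n] [a]) ρ) (n i : ℕ)
    (hi : i < (f (ρ n)).length) :
    (f (ρ n))[i]? = some (ρ (imageLength f ρ n + i)) := by
  have h1 : ∀ᶠ m in Filter.atTop, ∀ k ∈ Set.Iio (n + 1),
      ((applyWord f)^[m] [a])[k]? = some (ρ k) :=
    (Set.finite_Iio (n + 1)).eventually_all.mpr fun k _ => h k
  have h2 := (Filter.tendsto_add_atTop_nat 1).eventually (h (imageLength f ρ n + i))
  obtain ⟨m, hm1, hm2⟩ := (h1.and h2).exists
  have ht := take_eq_map_range (w := (applyWord f)^[m] [a]) (ρ := ρ) (n := n + 1)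
    (fun k hk => hm1 k hk)
  rw [← hm2]
  simp only [Function.iterate_succ_apply']
  rw [← List.take_append_drop (n + 1) ((applyWord f)^[m] [a]), ht, applyWord_append,
    List.range_succ, List.map_append, applyWord_append, List.append_assoc,
    List.getElem?_append_right (by simp [imageLength])]
  simp [imageLength, applyWord, List.getElem?_append, hi]

theorem IsLimitOfWords.apply_zero {Γ : Type*} {f : Γ → List Γ} {a : Γ} {u : List Γ} {ρ : ℕ → Γ}
    (hu : f a = a :: u) (h : IsLimitOfWords (fun n => (applyWord f)^[n] [a]) ρ) : ρ 0 = a := by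
  have key : ∀ n, ((applyWord f)^[n] [a])[0]? = some a := by
    intro n
    induction n with
    | zero => rfl
    | succ n ih =>
      rw [Function.iterate_succ_apply']
      cases hw : (applyWord f)^[n] [a] with
      | nil => simp [hw] at ih
      | cons b w =>
        obtain rfl : b = a := by simpa [hw] using ih
        simp [applyWord, hu]
  obtain ⟨n, hn⟩ := (h 0).exists
  simpa [key] using hn.symm

/-! ### Nodes of tree functions -/

namespace TreeFunction

variable (P : TreeFunction)

theorem nth_Ico {x y i : ℕ} (h : x + i < y) : Nat.nth (· ∈ Set.Ico x y) i = x + i := by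
  have hc : Nat.count (· ∈ Set.Ico x y) (x + i) = i := by
    rw [Nat.count_eq_card_filter_range]
    have : (Finset.range (x + i)).filter (· ∈ Set.Ico x y) = Finset.Ico x (x + i) := by
      ext m
      simp
      omega
    rw [this]
    simp
  have := Nat.nth_count (p := (· ∈ Set.Ico x y)) (n := x + i) ⟨by omega, h⟩
  rwa [hc] at this

theorem arity_of_children_eq {n x y : ℕ} (h : P.children n = Set.Ico x y) :
    (P.arity n : ℕ) = y - x := by
  change (P.children n).ncard = _
  rw [h, ← Finset.coe_Ico, Set.ncard_coe_finset, Nat.card_Ico]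

theorem child_of_children_eq {n x y i : ℕ} (h : P.children n = Set.Ico x y)
    (hi : i < (P.arity n : ℕ)) : P.child n i = x + i := by
  rw [P.arity_of_children_eq h] at hi
  rw [child, h]
  exact nth_Ico (by omega)

theorem lt_starts {s : ℕ → ℕ} (h0 : s 0 = 1) (hs : StrictMono s) (n : ℕ) : n < s n := by
  induction n with
  | zero => omega
  | succ n ih =>
    have := hs (Nat.lt_add_one n)
    omega

theorem exists_starts : ∃ s : ℕ → ℕ, s 0 = 1 ∧ StrictMono s ∧
    ∀ n, P.children n = Set.Ico (s n) (s (n + 1)) := by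
  classical
  have hex : ∀ n, ∃ j, ∃ h : 0 < j, n ≤ P.toFun ⟨j, h⟩ := fun n => by
    obtain ⟨j, hj⟩ := P.surj n
    exact ⟨j, j.pos, hj.ge⟩
  -- The start of the `n`-th interval is the first node whose parent is at least `n`; this
  -- equivalence turns membership in an interval into bounds on the parent.
  have hle : ∀ n (j : ℕ) (h : 0 < j), Nat.find (hex n) ≤ j ↔ n ≤ P.toFun ⟨j, h⟩ := by
    intro n j h
    refine ⟨fun hj => ?_, fun hj => Nat.find_min' _ ⟨h, hj⟩⟩
    obtain ⟨h0, h1⟩ := Nat.find_spec (hex n)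
    exact h1.trans (P.mono hj)
  have hch : ∀ n, P.children n = Set.Ico (Nat.find (hex n)) (Nat.find (hex (n + 1))) := by
    intro n
    ext m
    simp only [children, Set.mem_ofPred_eq, Set.mem_Ico]
    constructor
    · rintro ⟨h, hm⟩
      have h1 := hle n m h
      have h2 := hle (n + 1) m h
      omega
    · rintro ⟨h1, h2⟩
      have h : 0 < m := (Nat.find_spec (hex n)).1.trans_le h1
      have h1' := hle n m h
      have h2' := hle (n + 1) m h
      exact ⟨h, by omega⟩
  refine ⟨fun n => Nat.find (hex n), ?_, ?_, hch⟩
  · have h1 := (Nat.find_spec (hex 0)).1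
    have h2 := (hle 0 1 one_pos).mpr (Nat.zero_le _)
    show Nat.find (hex 0) = 1
    omega
  · refine strictMono_nat_of_lt_succ fun n => ?_
    obtain ⟨m, hm⟩ := P.children_nonempty n
    rw [hch n] at hm
    exact hm.1.trans_lt hm.2

theorem child_mem {n i : ℕ} (hi : i < (P.arity n : ℕ)) : P.child n i ∈ P.children n := by
  obtain ⟨s, -, -, hs⟩ := P.exists_starts
  have ha := P.arity_of_children_eq (hs n)
  rw [P.child_of_children_eq (hs n) hi, hs n]
  exact ⟨by omega, by omega⟩

theorem child_lt_child {n i j : ℕ} (hij : i < j) (hj : j < (P.arity n : ℕ)) :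
    P.child n i < P.child n j := by
  obtain ⟨s, -, -, hs⟩ := P.exists_starts
  rw [P.child_of_children_eq (hs n) hj, P.child_of_children_eq (hs n) (hij.trans hj)]
  omega

theorem lt_of_mem_children {n m x y : ℕ} (hnm : n < m) (hx : x ∈ P.children n)
    (hy : y ∈ P.children m) : x < y := by
  obtain ⟨h, hx⟩ := hx
  obtain ⟨h', hy⟩ := hy
  by_contra hlt
  have : (⟨y, h'⟩ : ℕ+) ≤ ⟨x, h⟩ := not_lt.mp hlt
  have := P.mono this
  omega

theorem nodeFrom_concat_eq_some {n : ℕ} {p : List ℕ} {i m : ℕ} :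
    P.nodeFrom n (p ++ [i]) = some m ↔
      ∃ k, P.nodeFrom n p = some k ∧ i < (P.arity k : ℕ) ∧ P.child k i = m := by
  rw [nodeFrom_append]
  cases P.nodeFrom n p with
  | none => simp
  | some k => simp [nodeFrom]

theorem lex_concat {p q : List ℕ} {i j : ℕ} (hl : q.length = p.length)
    (h : List.Lex (· < ·) (q ++ [j]) (p ++ [i])) : List.Lex (· < ·) q p ∨ q = p ∧ j < i := by
  induction q generalizing p with
  | nil =>
    obtain rfl : p = [] := List.length_eq_zero_iff.mp hl.symm
    cases h with
    | cons h => cases h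
    | rel h => exact Or.inr ⟨rfl, h⟩
  | cons a q ih =>
    cases p with
    | nil => simp at hl
    | cons b p =>
      cases h with
      | cons h =>
        rcases ih (by simpa using hl) h with h | ⟨rfl, hij⟩
        · exact Or.inl (.cons h)
        · exact Or.inr ⟨rfl, hij⟩
      | rel h => exact Or.inl (.rel h)

theorem shortlex_concat {p q : List ℕ} {i j : ℕ}
    (h : List.Shortlex (· < ·) (q ++ [j]) (p ++ [i])) :
    List.Shortlex (· < ·) q p ∨ q = p ∧ j < i := by
  rcases List.shortlex_def.mp h with h | ⟨hl, h⟩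
  · exact Or.inl (.of_length_lt (by simpa using h))
  · have hl : q.length = p.length := by simpa using hl
    exact (lex_concat hl h).imp_left (.of_lex hl)

/-- Comparing two positions reduces to comparing their parents, and monotonicity of `P` puts all
children of a smaller node before those of a larger one. -/
theorem node_lt_of_shortlex {p q : List ℕ} {n m : ℕ} (hq : P.nodeFrom 0 q = some n)
    (hp : P.nodeFrom 0 p = some m) (h : List.Shortlex (· < ·) q p) : n < m := by
  induction p using List.reverseRecOn generalizing q n m with
  | nil => simp [List.shortlex_def] at h
  | append_singleton p i ih =>
    obtain ⟨k, hk, hi, rfl⟩ := P.nodeFrom_concat_eq_some.mp hp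
    rcases List.eq_nil_or_concat' q with rfl | ⟨q, j, rfl⟩
    · obtain rfl : 0 = n := by simpa [nodeFrom] using hq
      exact (P.child_mem hi).1
    · obtain ⟨l, hl, hj, rfl⟩ := P.nodeFrom_concat_eq_some.mp hq
      rcases shortlex_concat h with h | ⟨rfl, hij⟩
      · exact P.lt_of_mem_children (ih hl hk h) (P.child_mem hj) (P.child_mem hi)
      · obtain rfl : l = k := by simpa [hl] using hk
        exact P.child_lt_child hij hi

theorem exists_nodeFrom_eq (n : ℕ) : ∃ p, P.nodeFrom 0 p = some n := by
  obtain ⟨s, h0, hs, hch⟩ := P.exists_starts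
  induction n using Nat.strong_induction_on with
  | _ n ih =>
    rcases Nat.eq_zero_or_pos n with rfl | hn
    · exact ⟨[], rfl⟩
    · set k := P.toFun ⟨n, hn⟩ with hk
      have hmem : n ∈ P.children k := ⟨hn, rfl⟩
      rw [hch k] at hmem
      -- Parents are smaller than their children, so the strong induction applies to `k`.
      have hlt : k < s k := lt_starts h0 hs k
      obtain ⟨p, hp⟩ := ih k (hlt.trans_le hmem.1)
      have ha := P.arity_of_children_eq (hch k)
      obtain ⟨h1, h2⟩ := hmem
      have hi : n - s k < (P.arity k : ℕ) := by omega
      refine ⟨p ++ [n - s k], P.nodeFrom_concat_eq_some.mpr ⟨k, hp, hi, ?_⟩⟩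
      rw [P.child_of_children_eq (hch k) hi]
      omega

theorem term_isPos_iff (p : List ℕ) : P.term.IsPos p ↔ ∃ n, P.nodeFrom 0 p = some n := by
  rw [← Option.isSome_iff_exists]
  unfold InfTerm.IsPos term
  by_cases h : P.tree.IsPos p
  · simpa [h] using (by simpa [InfTerm.IsPos, tree] using h)
  · simpa [h] using (by simpa [InfTerm.IsPos, tree] using h)

/-- `nodeFrom 0` is an order-preserving bijection from positions to nodes, so the positions before
`p` correspond to the nodes below `n`. -/
theorem number_eq {p : List ℕ} {n : ℕ} (hp : P.nodeFrom 0 p = some n) :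
    P.term.number p = n := by
  have hcard : (Set.Iio n).ncard = n := by
    rw [← Finset.coe_Iio, Set.ncard_coe_finset, Nat.card_Iio]
  rw [← hcard]
  unfold InfTerm.number
  refine Set.ncard_congr (fun q _ => (P.nodeFrom 0 q).getD 0) ?_ ?_ ?_
  · rintro q ⟨hq, hlt⟩
    obtain ⟨m, hm⟩ := (P.term_isPos_iff q).mp hq
    simpa [hm] using P.node_lt_of_shortlex hm hp hlt
  · rintro q q' ⟨hq, -⟩ ⟨hq', -⟩ h
    obtain ⟨m, hm⟩ := (P.term_isPos_iff q).mp hq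
    obtain ⟨m', hm'⟩ := (P.term_isPos_iff q').mp hq'
    obtain rfl : m = m' := by simpa [hm, hm'] using h
    rcases trichotomous_of (List.Shortlex (· < ·)) q q' with h | h | h
    · exact absurd (P.node_lt_of_shortlex hm hm' h) (lt_irrefl _)
    · exact h
    · exact absurd (P.node_lt_of_shortlex hm' hm h) (lt_irrefl _)
  · intro m hm
    obtain ⟨q, hq⟩ := P.exists_nodeFrom_eq m
    refine ⟨q, ⟨(P.term_isPos_iff q).mpr ⟨m, hq⟩, ?_⟩, by simp [hq]⟩
    rcases trichotomous_of (List.Shortlex (· < ·)) q p with h | rfl | h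
    · exact h
    · obtain rfl : m = n := by simpa [hq] using hp
      exact absurd (Set.mem_Iio.mp hm) (lt_irrefl _)
    · exact absurd (P.node_lt_of_shortlex hp hq h) (lt_asymm hm)

/-! ### Subtrees at nodes, and rationality through colourings of the nodes -/

/-- A position of the tree of `P` leading to the node `n`. -/
noncomputable def position (n : ℕ) : List ℕ := (P.exists_nodeFrom_eq n).choose

theorem nodeFrom_position (n : ℕ) : P.nodeFrom 0 (P.position n) = some n :=
  (P.exists_nodeFrom_eq n).choose_spec

theorem tree_isPos {p : List ℕ} {n : ℕ} (h : P.nodeFrom 0 p = some n) : P.tree.IsPos p := by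
  simp [InfTerm.IsPos, tree, h]

/-- The subtree of the tree of `P` at the node `n`. -/
noncomputable def subtreeAt (n : ℕ) : P.Subtree :=
  ⟨P.tree.subterm (P.position n) (P.tree_isPos (P.nodeFrom_position n)), _, _, rfl⟩

theorem subterm_toFun {S : Type*} {ar : S → ℕ+} {t : InfTerm ar} {g : ℕ → S}
    (ht : ∀ p, t.toFun p = (P.nodeFrom 0 p).map g) {p : List ℕ} {n : ℕ}
    (hn : P.nodeFrom 0 p = some n) (hp : t.IsPos p) (q : List ℕ) :
    (t.subterm p hp).toFun q = (P.nodeFrom n q).map g := by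
  simp [InfTerm.subterm, ht, nodeFrom_append, hn]

theorem tree_subterm_eq {p : List ℕ} {n : ℕ} (hn : P.nodeFrom 0 p = some n)
    (hp : P.tree.IsPos p) : P.tree.subterm p hp = (P.subtreeAt n).1 := by
  ext1
  funext q
  rw [P.subterm_toFun (fun _ => rfl) hn, subtreeAt,
    P.subterm_toFun (fun _ => rfl) (P.nodeFrom_position n)]

theorem subtreeAt_arity (n : ℕ) : (P.subtreeAt n).arity = P.arity n := by
  have h : (P.subtreeAt n).1.toFun [] = some (P.arity n) :=
    P.subterm_toFun (fun _ => rfl) (P.nodeFrom_position n)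
      (P.tree_isPos (P.nodeFrom_position n)) []
  simp [Subtree.arity, InfTerm.symbol, h]

theorem labelledTerm_toFun {A : Type*} (σ : ℕ → A) (p : List ℕ) :
    (P.labelledTerm σ).toFun p = (P.nodeFrom 0 p).map fun n => (P.subtreeAt n, σ n) := by
  cases h : P.nodeFrom 0 p with
  | none =>
    have h' : ¬ P.tree.IsPos p := by simp [InfTerm.IsPos, tree, h]
    simp [labelledTerm, term, h']
  | some n =>
    have h' := P.tree_isPos h
    have ht : P.term.toFun p = some (P.subtreeAt n) := by
      simp [term, h', P.tree_subterm_eq h]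
    change (P.term.toFun p).map (fun s => (s, σ (P.term.number p))) = _
    rw [ht, P.number_eq h]
    rfl

/-- The colour of a node determines its number of children and their colours. -/
def IsColouring {Γ : Type*} (c : ℕ → Γ) : Prop :=
  ∀ n m, c n = c m → P.arity n = P.arity m ∧
    ∀ i < (P.arity n : ℕ), c (P.child n i) = c (P.child m i)

variable {P}

theorem IsColouring.map_nodeFrom {Γ : Type*} {c : ℕ → Γ} (hc : P.IsColouring c) {n m : ℕ}
    (h : c n = c m) (q : List ℕ) : (P.nodeFrom n q).map c = (P.nodeFrom m q).map c := by
  induction q generalizing n m with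
  | nil => simp [nodeFrom, h]
  | cons i q ih =>
    obtain ⟨ha, hch⟩ := hc n m h
    simp only [nodeFrom, ← ha]
    split_ifs with hi
    · exact ih (hch i hi)
    · rfl

theorem IsColouring.map_nodeFrom_eq {Γ S : Type*} {c : ℕ → Γ} (hc : P.IsColouring c)
    {g : ℕ → S} (hg : ∀ n m, c n = c m → g n = g m) {n m : ℕ} (h : c n = c m) (q : List ℕ) :
    (P.nodeFrom n q).map g = (P.nodeFrom m q).map g := by
  have := hc.map_nodeFrom h q
  cases h1 : P.nodeFrom n q <;> cases h2 : P.nodeFrom m q <;> simp_all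
  exact hg _ _ this

theorem IsColouring.isRational {Γ S : Type*} [Finite Γ] {c : ℕ → Γ} (hc : P.IsColouring c)
    {ar : S → ℕ+} {t : InfTerm ar} {g : ℕ → S} (ht : ∀ p, t.toFun p = (P.nodeFrom 0 p).map g)
    (hg : ∀ n m, c n = c m → g n = g m) : t.IsRational := by
  have hpos : ∀ n, t.IsPos (P.position n) := fun n => by
    simp [InfTerm.IsPos, ht, P.nodeFrom_position]
  let T : ℕ → InfTerm ar := fun n => t.subterm (P.position n) (hpos n)
  have hT : ∀ n m, c n = c m → T n = T m := by
    intro n m h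
    ext1
    funext q
    rw [P.subterm_toFun ht (P.nodeFrom_position n), P.subterm_toFun ht (P.nodeFrom_position m)]
    exact hc.map_nodeFrom_eq hg h q
  refine (Set.finite_range fun x => T (Function.invFun c x)).subset ?_
  rintro s ⟨p, hp, rfl⟩
  have hp' := hp
  simp only [InfTerm.IsPos, ht, Option.isSome_map, Option.isSome_iff_exists] at hp'
  obtain ⟨n, hn⟩ := hp'
  refine ⟨c n, ?_⟩
  change T (Function.invFun c (c n)) = _
  rw [hT (Function.invFun c (c n)) n (Function.invFun_eq ⟨n, rfl⟩)]
  ext1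
  funext q
  rw [P.subterm_toFun ht hn, P.subterm_toFun ht (P.nodeFrom_position n)]

/-- The colour of a node is the subterm there: it determines its root symbol and its immediate
subterms. -/
theorem exists_colouring_of_isRational {A : Type*} {σ : ℕ → A}
    (h : (P.labelledTerm σ).IsRational) :
    ∃ (k : ℕ) (c : ℕ → Fin k), P.IsColouring c ∧ ∀ n m, c n = c m → σ n = σ m := by
  set t := P.labelledTerm σ with hT
  have ht : ∀ p, t.toFun p = (P.nodeFrom 0 p).map fun n => (P.subtreeAt n, σ n) :=
    P.labelledTerm_toFun σ
  have hpos : ∀ n, t.IsPos (P.position n) := fun n => by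
    simp [InfTerm.IsPos, ht, P.nodeFrom_position]
  have : Finite t.subterms := h
  -- Colours in `Fin k` live in `Type`, as `IsMorphic` requires, whatever the universe of `A`.
  obtain ⟨k, ⟨e⟩⟩ := Finite.exists_equiv_fin t.subterms
  let T : ℕ → t.subterms := fun n => ⟨t.subterm (P.position n) (hpos n), _, _, rfl⟩
  have hTq : ∀ n m, T n = T m ↔ ∀ q, (P.nodeFrom n q).map (fun n => (P.subtreeAt n, σ n)) =
      (P.nodeFrom m q).map fun n => (P.subtreeAt n, σ n) := by
    intro n m
    rw [Subtype.ext_iff]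
    simp only [T, InfTerm.ext_iff, funext_iff,
      P.subterm_toFun ht (P.nodeFrom_position n), P.subterm_toFun ht (P.nodeFrom_position m)]
  have hroot : ∀ n m, T n = T m → P.subtreeAt n = P.subtreeAt m ∧ σ n = σ m := by
    intro n m hnm
    simpa [nodeFrom] using (hTq n m).mp hnm []
  have har : ∀ n m, T n = T m → P.arity n = P.arity m := by
    intro n m hnm
    rw [← subtreeAt_arity, ← subtreeAt_arity, (hroot n m hnm).1]
  refine ⟨k, e ∘ T, fun n m hnm => ?_, fun n m hnm => (hroot n m (e.injective hnm)).2⟩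
  have hnm : T n = T m := e.injective hnm
  refine ⟨har n m hnm, fun i hi => congrArg e ((hTq _ _).mpr fun q => ?_)⟩
  have := (hTq n m).mp hnm (i :: q)
  simpa only [nodeFrom, ← har n m hnm, if_pos hi] using this

/-- There is a tree function for which the children of `n` are the numbers from `s n` to `s (n + 1) - 1`. -/
theorem exists_of_starts {s : ℕ → ℕ} (h0 : s 0 = 1) (hs : StrictMono s) :
    ∃ P : TreeFunction, ∀ n, P.children n = Set.Ico (s n) (s (n + 1)) := by
  have hex : ∀ j : ℕ+, ∃ n, s n ≤ j ∧ j < s (n + 1) := by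
    intro j
    have := j.pos
    obtain ⟨n, hn⟩ : ∃ n, (j : ℕ) < s (n + 1) :=
      ⟨j, (Nat.lt_add_one _).trans_le (hs.le_apply)⟩
    induction n with
    | zero => exact ⟨0, by omega, hn⟩
    | succ n ih =>
      by_cases h : (j : ℕ) < s (n + 1)
      · exact ih h
      · exact ⟨n + 1, by omega, hn⟩
  choose F hF using hex
  have huniq : ∀ (j : ℕ+) n, s n ≤ j → j < s (n + 1) → F j = n := by
    intro j n h1 h2
    have h3 := hs.lt_iff_lt.mp ((hF j).1.trans_lt h2)
    have h4 := hs.lt_iff_lt.mp (h1.trans_lt (hF j).2)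
    omega
  refine ⟨⟨F, fun i j hij => ?_, fun n => ?_⟩, fun n => ?_⟩
  · have hij' : (i : ℕ) ≤ j := hij
    have := hs.lt_iff_lt.mp (((hF i).1.trans hij').trans_lt (hF j).2)
    omega
  · have : 0 < s n := by have := hs.monotone (Nat.zero_le n); omega
    exact ⟨⟨s n, this⟩, huniq _ n le_rfl (hs (Nat.lt_add_one n))⟩
  · ext m
    constructor
    · rintro ⟨h, rfl⟩
      exact hF ⟨m, h⟩
    · rintro ⟨h1, h2⟩
      have : 0 < s n := by have := hs.monotone (Nat.zero_le n); omega
      exact ⟨this.trans_le h1, huniq _ n h1 h2⟩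

end TreeFunction

/-! ### The two implications -/

open TreeFunction

theorem IsMorphic.exists_treeFunction {A : Type*} {σ : ℕ → A} (h : IsMorphic σ) :
    ∃ P : TreeFunction, P.IsRational ∧ (P.labelledTerm σ).IsRational := by
  obtain ⟨Γ, τ, ρ, ⟨hfin, f, a, u, hne, hu, hfa, hlim⟩, rfl⟩ := h
  have hρ0 : ρ 0 = a := hlim.apply_zero hfa
  have hlen : ∀ b, 0 < (f b).length := fun b => List.length_pos_iff.mpr (hne b)
  -- The value `1` at `0`, in place of the image length `0`, keeps the root from being its own
  -- child. Then `s 0 < s 1` because `u` is nonempty.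
  let s : ℕ → ℕ := fun n => if n = 0 then 1 else imageLength f ρ n
  have hs : StrictMono s := by
    refine strictMono_nat_of_lt_succ fun n => ?_
    have := hlen (ρ n)
    cases n with
    | zero => simp [s, imageLength, applyWord, hρ0, hfa, List.length_pos_iff.mpr hu]
    | succ n => simp [s, imageLength_succ f ρ (n + 1), *]
  obtain ⟨P, hP⟩ := TreeFunction.exists_of_starts (s := s) rfl hs
  have har : ∀ n, n ≠ 0 → (P.arity n : ℕ) = (f (ρ n)).length := by
    intro n hn
    rw [P.arity_of_children_eq (hP n)]
    simp [s, hn, imageLength_succ]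
  -- The root needs its own colour: the letter `a` may recur in `ρ`, and later occurrences have one
  -- child more.
  let c : ℕ → Option Γ := fun n => if n = 0 then none else some (ρ n)
  have hcρ : ∀ n m, c n = c m → ρ n = ρ m := by
    intro n m h
    by_cases hn : n = 0 <;> by_cases hm : m = 0 <;> simp_all [c]
  have hchild : ∀ n, n ≠ 0 → ∀ i, i < (P.arity n : ℕ) → c (P.child n i) = (f (ρ n))[i]? := by
    intro n hn i hi
    rw [hlim.getElem?_image n i (by rwa [← har n hn])]
    have h1 : P.child n i = imageLength f ρ n + i := by
      rw [P.child_of_children_eq (hP n) hi]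
      simp [s, hn]
    have h2 := (P.child_mem hi).1
    rw [← h1]
    simp [c, h2.ne']
  have hc : P.IsColouring c := by
    intro n m h
    by_cases hn : n = 0
    · obtain rfl : n = m := by
        by_cases hm : m = 0 <;> simp_all [c]
      exact ⟨rfl, fun _ _ => rfl⟩
    · have hm : m ≠ 0 := by rintro rfl; simp [c, hn] at h
      have hnm : P.arity n = P.arity m := PNat.eq (by rw [har n hn, har m hm, hcρ n m h])
      refine ⟨hnm, fun i hi => ?_⟩
      rw [hchild n hn i hi, hchild m hm i (hnm ▸ hi), hcρ n m h]
  refine ⟨P, hc.isRational (fun _ => rfl) fun n m h => (hc n m h).1,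
    hc.isRational (P.labelledTerm_toFun _) fun n m h => ?_⟩
  refine Prod.ext (Subtype.ext ?_) (congrArg τ (hcρ n m h))
  ext1
  funext q
  simp only [subtreeAt]
  rw [P.subterm_toFun (fun _ => rfl) (P.nodeFrom_position n),
    P.subterm_toFun (fun _ => rfl) (P.nodeFrom_position m)]
  exact hc.map_nodeFrom_eq (fun n m h => (hc n m h).1) h q

theorem isMorphic_of_isRational {A : Type*} {σ : ℕ → A} {P : TreeFunction}
    (h : (P.labelledTerm σ).IsRational) : IsMorphic σ := by
  obtain ⟨k, c, hc, hσ⟩ := exists_colouring_of_isRational h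
  obtain ⟨s, h0, hs, hch⟩ := P.exists_starts
  -- A node representing each colour; the default value at colours that do not occur is harmless.
  let r : Fin k → ℕ := Function.invFun c
  have hr : ∀ n, c (r (c n)) = c n := fun n => Function.invFun_eq ⟨n, rfl⟩
  let word : ℕ → List (Option (Fin k)) := fun n =>
    (List.range (P.arity n : ℕ)).map fun i => some (c (P.child n i))
  have hword : ∀ n, word n ≠ [] := fun n => by simp [word]
  have hwc : ∀ n, word (r (c n)) = word n := by
    intro n
    obtain ⟨h1, h2⟩ := hc _ _ (hr n)
    simp only [word]
    rw [← h1]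
    refine List.map_congr_left fun i hi => ?_
    rw [h2 i (List.mem_range.mp hi)]
  let f : Option (Fin k) → List (Option (Fin k)) := fun x =>
    x.elim (none :: word 0) fun y => word (r y)
  let ρ : ℕ → Option (Fin k) := fun n => if n = 0 then none else some (c n)
  have hwρ : ∀ n, (List.range (s n)).map ρ ++ word n = (List.range (s (n + 1))).map ρ := by
    intro n
    have ha := P.arity_of_children_eq (hch n)
    have hlt := hs (Nat.lt_add_one n)
    have he : s (n + 1) = s n + (P.arity n : ℕ) := by omega
    rw [he, List.range_add, List.map_append, List.map_map]
    congr 1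
    refine List.map_congr_left fun i hi => ?_
    have hi := List.mem_range.mp hi
    have h1 := (P.child_mem hi).1
    rw [P.child_of_children_eq (hch n) hi] at h1 ⊢
    simp only [Function.comp, ρ, if_neg h1.ne']
  -- The prefix must be nonempty: the leading `none` in the image of the root letter supplies entry
  -- `0`, which lies in no block of children.
  have hpre : ∀ n, applyWord f ((List.range (n + 1)).map ρ) = (List.range (s (n + 1))).map ρ := by
    intro n
    induction n with
    | zero =>
      rw [← hwρ 0, h0]
      simp [applyWord, f, ρ]
    | succ n ih =>
      rw [List.range_succ, List.map_append, applyWord_append, ih, ← hwρ (n + 1)]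
      simp [applyWord, f, ρ, hwc]
  refine ⟨Option (Fin k), fun x => x.elim (σ 0) fun y => σ (r y), ρ,
    ⟨inferInstance, f, none, word 0, ?_, hword 0, rfl, ?_⟩, ?_⟩
  · rintro (_ | y)
    · simp [f]
    · exact hword _
  · refine isLimitOfWords_of_prefixes (ρ := ρ) (lt_starts h0 hs) fun n hn => ?_
    obtain ⟨m, rfl⟩ := Nat.exists_eq_add_of_le' hn
    exact hpre m
  · funext n
    by_cases hn : n = 0
    · simp [ρ, hn]
    · simp [ρ, hn, hσ _ _ (hr n)]

end MorphicSeq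

theorem mainTheorem3 {A : Type*} [Finite A] (σ : ℕ → A) :
    MorphicSeq.IsMorphic σ ↔
      ∃ P : MorphicSeq.TreeFunction, P.IsRational ∧ (P.labelledTerm σ).IsRational :=
  ⟨fun h => h.exists_treeFunction, fun ⟨_, _, h⟩ => MorphicSeq.isMorphic_of_isRational h⟩
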